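/- Let $(\Omega,\mathcal F,\mu)$ be a $\sigma$-finite measure space which does not consist of a single atom, i.e. some $A\in\mathcal F$ has $\mu(A)>0$ and $\mu(\Omega\setminus A)>0$, and let $T$ be a non-singular automorphism of it: a bijective bi-measurable map $T:\Omega\to\Omega$ with $T_*\mu\sim\mu$. Relations between sets and $\sigma$-algebras are understood modulo null sets. The system $(\Omega,\mathcal F,\mu,T)$ is a *$K$-system* if it is conservative (there is no set $A$ of positive measure whose images $T^iA$, $i\in\mathbb Z$, are disjoint) and there is a sub-$\sigma$-algebra $\mathcal G\subset\mathcal F$ such that $T^{-1}\mathcal G\subset\mathcal G$, $\bigcap_{n\ge 1}T^{-n}\mathcal G=\{\Omega,\emptyset\}$, $\bigvee_{n\ge 0}T^{n}\mathcal G=\mathcal F$, and $\frac{d\mu}{dT_*\mu}$ is $\mathcal G$-measurable. It is of *type $\mathrm{II}_1$* if there is a finite $T$-invariant measure equivalent to $\mu$ and there is no periodic set, where a set $A\in\mathcal F$ with $\mu(A)>0$ is periodic if for some $n\ge1$ the sets $A,TA,\dots,T^{n-1}A$ are disjoint and $T^n$ acts as the identity on $A$, i.e. $T^nB=B$ for every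 measurable $B\subset A$. Let $0<\alpha<2$. The *Maharam extension* of $(\Omega,\mathcal F,\mu,T)$ is the space $\left(\Omega\times\mathbb R_+^*,\ \mathcal F\otimes\mathcal B_+,\ \mu\otimes\frac{1}{s^{1+\alpha}}ds\right)$, where $\mathbb R_+^*=(0,\infty)$ has Borel $\sigma$-algebra $\mathcal B_+$, with the transformation $$\widetilde T_\alpha(\omega,s)=\left(T\omega,\ s\left(\frac{dT^{-1}_*\mu}{d\mu}(\omega)\right)^{1/\alpha}\right),$$ for a version of the Radon–Nikodym derivative with values in $(0,\infty)$. **Proposition.** If $(\Omega,\mathcal F,\mu,T)$ is a $K$-system which is not of type $\mathrm{II}_1$, then its Maharam extension is remotely infinite, that is, $\widetilde T_\alpha$ preserves the measure $\mu\otimes\frac{1}{s^{1+\alpha}}ds$ and there is a sub-$\sigma$-algebra $\mathcal C\subset\mathcal F\otimes\mathcal B_+$ such that $\widetilde T_\alpha^{-1}\mathcal C\subset\mathcal C$, $\bigvee_{n\ge0}\widetilde T_\alpha^{\,n}\mathcal C=\mathcal F\otimes\mathcal B_+$, and every set in $\bigcap_{n\ge1}\widetilde T_\alpha^{-n}\mathcal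 C$ has measure zero or infinite measure. -/

import Mathlib

open MeasureTheory
open scoped ENNReal

noncomputable section

namespace Maharam

/-- A bijective bi-measurable map `T` is a non-singular automorphism of `(Ω, μ)` if the
image measure `T_* μ` is equivalent to `μ`. -/
structure IsNonsingular {Ω : Type*} [MeasurableSpace Ω] (T : Ω ≃ᵐ Ω) (μ : Measure Ω) : Prop where
  map_ac : μ.map T ≪ μ
  ac_map : μ ≪ μ.map T

/-- The tail `⋂ₙ T⁻ⁿ G` of a σ-algebra `G`. -/
@[reducible] def tail {Ω : Type*} (T : Ω → Ω) (G : MeasurableSpace Ω) : MeasurableSpace Ω :=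
  ⨅ n : ℕ, G.comap T^[n]

/-- The σ-algebra generated by the images `Tⁿ G`, `n ≥ 0`; the image `Tⁿ G` is the
pull-back of `G` under the `n`-th iterate of `T⁻¹`. -/
@[reducible] def forwardSpan {Ω : Type*} (G : MeasurableSpace Ω) {m : MeasurableSpace Ω}
    (T : Ω ≃ᵐ Ω) : MeasurableSpace Ω :=
  ⨆ n : ℕ, G.comap T.symm^[n]

/-- `G` is a sub-σ-algebra with `T⁻¹ G ⊆ G` and `Tⁿ G ↑ m` modulo `μ`-null sets. -/
structure IsExhausting {Ω : Type*} (G : MeasurableSpace Ω) {m : MeasurableSpace Ω}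
    (T : Ω ≃ᵐ Ω) (μ : Measure Ω) : Prop where
  le : G ≤ m
  comap_le : G.comap T ≤ G
  generates : ∀ A : Set Ω, MeasurableSet[m] A →
    ∃ B : Set Ω, MeasurableSet[forwardSpan G T] B ∧ A =ᵐ[μ] B

/-- The `K`-property of `T` is witnessed by `G`: it is exhausting, has a tail that is trivial modulo
null sets, and `dμ / dT_* μ` agrees almost everywhere with a `G`-measurable function. -/
structure IsKAlgebra {Ω : Type*} (G : MeasurableSpace Ω) {m : MeasurableSpace Ω}
    (T : Ω ≃ᵐ Ω) (μ : Measure Ω) : Prop where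
  exhausting : IsExhausting G T μ
  tail_trivial : ∀ A : Set Ω, MeasurableSet[tail T G] A → μ A = 0 ∨ μ Aᶜ = 0
  rnDeriv_measurable : ∃ φ : Ω → ℝ≥0∞, Measurable[G] φ ∧ μ.rnDeriv (μ.map T) =ᵐ[μ] φ

/-- Non-singular `K`-systems. `Conservative` says that no measurable set of positive measure is
wandering. -/
structure IsKSystem {Ω : Type*} [MeasurableSpace Ω] (T : Ω ≃ᵐ Ω) (μ : Measure Ω) : Prop where
  nonsingular : IsNonsingular T μ
  conservative : Conservative T μ
  exists_algebra : ∃ G : MeasurableSpace Ω, IsKAlgebra G T μ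

/-- A set `A` of positive measure is periodic of period `n ≥ 1` if `A, T A, …, Tⁿ⁻¹ A` are
disjoint and `Tⁿ` acts as the identity on `A` (at the level of measurable sets,
modulo null sets). -/
structure IsPeriodicSet {Ω : Type*} [MeasurableSpace Ω] (T : Ω ≃ᵐ Ω) (μ : Measure Ω)
    (n : ℕ) (A : Set Ω) : Prop where
  measurableSet : MeasurableSet A
  measure_ne_zero : μ A ≠ 0
  pos : 0 < n
  disjoint : ∀ i < n, ∀ j < n, i ≠ j → Disjoint (T^[i] '' A) (T^[j] '' A)
  image_eq : ∀ B ⊆ A, MeasurableSet B → (T^[n] '' B : Set Ω) =ᵐ[μ] B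

/-- Krieger type `II₁`: there is no periodic set, and there is a finite `T`-invariant measure
equivalent to `μ`. -/
def IsTypeII1 {Ω : Type*} [MeasurableSpace Ω] (T : Ω ≃ᵐ Ω) (μ : Measure Ω) : Prop :=
  (¬ ∃ (n : ℕ) (A : Set Ω), IsPeriodicSet T μ n A) ∧
  ∃ ν : Measure Ω, IsFiniteMeasure ν ∧ ν ≪ μ ∧ μ ≪ ν ∧ MeasurePreserving T ν ν

/-- A measure-preserving system is remotely infinite if some sub-σ-algebra `C` satisfies
`S⁻¹ C ⊆ C` and `Sⁿ C ↑ m`, and has in its tail only sets of measure zero or infinity. -/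
structure IsRemotelyInfinite {X : Type*} {m : MeasurableSpace X} (S : X ≃ᵐ X) (ρ : Measure X) :
    Prop where
  measurePreserving : MeasurePreserving S ρ ρ
  exists_algebra : ∃ C : MeasurableSpace X, IsExhausting C S ρ ∧
    ∀ A : Set X, MeasurableSet[tail S C] A → ρ A = 0 ∨ ρ A = ∞

/-- The half-line `ℝ₊* = (0, ∞)`. -/
abbrev PosReal : Type := Set.Ioi (0 : ℝ)

/-- The measure `s^(-1-α) ds` on `(0, ∞)`. -/
def powerMeasure (α : ℝ) : Measure PosReal :=
  (Measure.comap (Subtype.val : PosReal → ℝ) volume).withDensity fun s => ENNReal.ofReal (1 / (s : ℝ) ^ (1 + α))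

/-- A real version of the Radon-Nikodym derivative `d(T⁻¹)_* μ / dμ`, with the value `1` where
`Measure.rnDeriv` is `0` or `∞` (a null set if `T` is non-singular and `μ` is σ-finite),
so that it is everywhere positive. -/
def jacobian {Ω : Type*} [MeasurableSpace Ω] (T : Ω ≃ᵐ Ω) (μ : Measure Ω) (ω : Ω) : ℝ :=
  if 0 < (((μ.map T.symm).rnDeriv μ) ω).toReal then (((μ.map T.symm).rnDeriv μ) ω).toReal else 1

theorem jacobian_pos {Ω : Type*} [MeasurableSpace Ω] (T : Ω ≃ᵐ Ω) (μ : Measure Ω) (ω : Ω) :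
    0 < jacobian T μ ω := by
  unfold jacobian
  split_ifs with h
  · exact h
  · exact one_pos

theorem measurable_jacobian {Ω : Type*} [MeasurableSpace Ω] (T : Ω ≃ᵐ Ω) (μ : Measure Ω) :
    Measurable (jacobian T μ) := by
  have h : Measurable fun ω => (((μ.map T.symm).rnDeriv μ) ω).toReal :=
    (Measure.measurable_rnDeriv _ _).ennreal_toReal
  exact Measurable.ite (measurableSet_lt measurable_const h) h measurable_const

/-- The Maharam extension
`(ω, s) ↦ (T ω, s * (d(T⁻¹)_* μ / dμ (ω)) ^ (1 / α))` on `Ω × (0, ∞)`. -/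
def extension {Ω : Type*} [MeasurableSpace Ω] (T : Ω ≃ᵐ Ω) (μ : Measure Ω) (α : ℝ) :
    Ω × PosReal ≃ᵐ Ω × PosReal where
  toFun p := (T p.1, ⟨(p.2 : ℝ) * jacobian T μ p.1 ^ (1 / α),
    mul_pos p.2.2 (Real.rpow_pos_of_pos (jacobian_pos T μ _) _)⟩)
  invFun p := (T.symm p.1, ⟨(p.2 : ℝ) / jacobian T μ (T.symm p.1) ^ (1 / α),
    div_pos p.2.2 (Real.rpow_pos_of_pos (jacobian_pos T μ _) _)⟩)
  left_inv p := by
    have h := (Real.rpow_pos_of_pos (jacobian_pos T μ p.1) (1 / α)).ne'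
    ext
    · simp
    · simp only [MeasurableEquiv.symm_apply_apply]
      exact mul_div_cancel_right₀ _ h
  right_inv p := by
    have h := (Real.rpow_pos_of_pos (jacobian_pos T μ (T.symm p.1)) (1 / α)).ne'
    ext
    · simp
    · exact div_mul_cancel₀ _ h
  measurable_toFun := by
    have h := measurable_jacobian T μ
    refine (T.measurable.comp measurable_fst).prodMk (Measurable.subtype_mk ?_)
    exact (measurable_subtype_coe.comp measurable_snd).mul
      ((h.comp measurable_fst).pow_const _)
  measurable_invFun := by
    have h := measurable_jacobian T μ
    refine (T.symm.measurable.comp measurable_fst).prodMk (Measurable.subtype_mk ?_)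
    exact (measurable_subtype_coe.comp measurable_snd).div
      ((h.comp (T.symm.measurable.comp measurable_fst)).pow_const _)

end Maharam

end

/-! The witness is `G ⊗ B₊`, completed. Suppose a tail set `E = S⁻ⁿ Fₙ` of the extension `S` has
finite positive measure, and let `fₙ(ω)` be the measure of the fibre of `Fₙ` over `ω`. Then `fₙ = J
· fₙ₊₁ ∘ T`, with `J` the Jacobian, and each `fₙ` is `G`-measurable modulo null sets. The factor `J`
cancels from comparisons, so `{f₁ < f₀}` and `{f₀ ≠ 0}` lie in every `T⁻ⁿ G` modulo null sets and
are trivial (`IsKAlgebra.null_or_conull_of_coherent`). As `f₀` and `f₁` have the same finite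
integral, `f₀ = f₁ > 0` a.e., so `f₀ μ` is a finite invariant measure equivalent to `μ`
(`exists_invariant_of_remote`).

Under such a measure every power of `T` is ergodic (`null_or_conull_of_preimage_iterate`), whereas
all subsets of a periodic set are invariant under one power. As the space is not a single atom, no
periodic set exists, and `T` is of type `II₁`. -/

namespace Maharam

/-! ### Tail triviality modulo null sets. -/

section Tail

variable {Ω : Type*} {G m : MeasurableSpace Ω}

theorem antitone_comap_iterate {T : Ω → Ω} (hG : G.comap T ≤ G) :
    Antitone fun n : ℕ => G.comap T^[n] := by
  refine antitone_nat_of_succ_le fun n => ?_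
  rw [Function.iterate_succ', ← MeasurableSpace.comap_comp]
  exact MeasurableSpace.comap_mono hG

/-- Borel–Cantelli: a set that is approximated fast enough by sets `B i ∈ T⁻ⁱ G` belongs to the
tail of `G` modulo null sets. -/
theorem exists_tail_ae_eq {T : Ω → Ω} (hG : G.comap T ≤ G) {μ : Measure Ω} {U : Set Ω}
    {B : ℕ → Set Ω} (hB : ∀ i, MeasurableSet[G.comap T^[i]] (B i))
    (hsum : ∑' i, μ (symmDiff (B i) U) ≠ ∞) :
    ∃ A : Set Ω, MeasurableSet[tail T G] A ∧ U =ᵐ[μ] A := by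
  refine ⟨Filter.limsup B Filter.atTop, ?_, ?_⟩
  · rw [MeasurableSpace.measurableSet_iInf]
    intro n
    -- Dropping the first `n` terms leaves the limsup unchanged, and all remaining terms lie in `T⁻ⁿ
    -- G`.
    rw [← Filter.limsup_nat_add B n]
    refine @MeasurableSet.measurableSet_limsup Ω (G.comap T^[n]) _ fun i => ?_
    exact antitone_comap_iterate hG (Nat.le_add_left n i) _ (hB (i + n))
  · refine Filter.eventuallyEq_set.2 ?_
    filter_upwards [ae_eventually_notMem hsum] with x hx
    rw [Filter.mem_limsup_iff_frequently_mem]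
    have hx' : ∀ᶠ i in Filter.atTop, (x ∈ B i ↔ x ∈ U) := by
      filter_upwards [hx] with i hi
      rw [Set.mem_symmDiff] at hi
      tauto
    rw [Filter.frequently_congr hx', Filter.frequently_const]

theorem null_or_conull_of_tail_approx {T : Ω → Ω} (hG : G.comap T ≤ G) {μ : Measure Ω}
    (htriv : ∀ A : Set Ω, MeasurableSet[tail T G] A → μ A = 0 ∨ μ Aᶜ = 0) {U : Set Ω}
    {B : ℕ → Set Ω} (hB : ∀ i, MeasurableSet[G.comap T^[i]] (B i))
    (hsum : ∑' i, μ (symmDiff (B i) U) ≠ ∞) : μ U = 0 ∨ μ Uᶜ = 0 := by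
  obtain ⟨A, hA, hUA⟩ := exists_tail_ae_eq hG hB hsum
  rw [measure_congr hUA, measure_congr hUA.compl]
  exact htriv A hA

/-- A set that belongs to each `T⁻ⁿ G` modulo null sets is trivial. -/
theorem null_or_conull_of_ae_eq {T : Ω → Ω} (hG : G.comap T ≤ G) {μ : Measure Ω}
    (htriv : ∀ A : Set Ω, MeasurableSet[tail T G] A → μ A = 0 ∨ μ Aᶜ = 0) {U : Set Ω}
    (hU : ∀ i : ℕ, ∃ B : Set Ω, MeasurableSet[G.comap T^[i]] B ∧ B =ᵐ[μ] U) :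
    μ U = 0 ∨ μ Uᶜ = 0 := by
  choose B hB hBU using hU
  refine null_or_conull_of_tail_approx hG htriv hB ?_
  simp [measure_symmDiff_eq_zero_iff.2 (hBU _)]

end Tail

/-! ### Ergodicity of powers under a finite invariant measure, and absence of periodic sets. -/

section Periodic

variable {Ω : Type*} {G m : MeasurableSpace Ω}

theorem monotone_comap_symm_iterate {T : Ω ≃ᵐ Ω} (hG : G.comap T ≤ G) :
    Monotone fun n : ℕ => G.comap T.symm^[n] := by
  refine monotone_nat_of_le_succ fun n => ?_
  have h : G ≤ G.comap T.symm := by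
    have := MeasurableSpace.comap_mono (g := T.symm) hG
    rwa [MeasurableSpace.comap_comp, T.self_comp_symm, MeasurableSpace.comap_id] at this
  rw [Function.iterate_succ', ← MeasurableSpace.comap_comp]
  exact MeasurableSpace.comap_mono h

theorem comap_symm_iterate_le {T : Ω ≃ᵐ Ω} (hG : G ≤ m) (n : ℕ) :
    G.comap T.symm^[n] ≤ m :=
  (MeasurableSpace.comap_mono hG).trans (T.symm.measurable.iterate n).comap_le

/-- Sets of an exhausted σ-algebra are approximated by the sets in the `Tⁿ G`. -/
theorem IsExhausting.exists_measure_symmDiff_lt {T : Ω ≃ᵐ Ω} {ν : Measure Ω} [IsFiniteMeasure ν]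
    (h : IsExhausting G T ν) {U : Set Ω} (hU : MeasurableSet[m] U) {ε : ℝ≥0∞} (hε : 0 < ε) :
    ∃ (k : ℕ) (B : Set Ω), MeasurableSet[G.comap T.symm^[k]] B ∧ ν (symmDiff B U) < ε := by
  obtain ⟨V, hV, hUV⟩ := h.generates U hU
  have hle : forwardSpan G T ≤ m := iSup_le fun n => comap_symm_iterate_le h.le n
  have hmono := monotone_comap_symm_iterate h.comap_le
  -- An increasing union of σ-algebras is a ring of sets generating the span, hence dense in it for
  -- a finite measure.
  set 𝒞 : Set (Set Ω) := ⋃ n : ℕ, {t | MeasurableSet[G.comap T.symm^[n]] t} with h𝒞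
  have hmem : ∀ t, t ∈ 𝒞 ↔ ∃ n : ℕ, MeasurableSet[G.comap T.symm^[n]] t := fun t => by
    simp only [h𝒞, Set.mem_iUnion, Set.mem_ofPred_eq]
  have hring : IsSetRing 𝒞 := by
    refine ⟨(hmem _).2 ⟨0, @MeasurableSet.empty _ (_)⟩, fun s t hs ht => ?_, fun s t hs ht => ?_⟩ <;>
    · obtain ⟨i, hi⟩ := (hmem _).1 hs
      obtain ⟨j, hj⟩ := (hmem _).1 ht
      have hi' := hmono (le_max_left i j) _ hi
      have hj' := hmono (le_max_right i j) _ hj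
      first
        | exact (hmem _).2 ⟨_, hi'.union hj'⟩
        | exact (hmem _).2 ⟨_, hi'.diff hj'⟩
  have hfin : IsFiniteMeasure (ν.trim hle) := isFiniteMeasure_trim hle
  obtain ⟨B, hB, hBV⟩ := @exists_measure_symmDiff_lt_of_generateFrom_isSetRing Ω
    (forwardSpan G T) (ν.trim hle) _ 𝒞 hring
    ⟨{Set.univ}, Set.countable_singleton _, by
      simpa using (hmem _).2 ⟨0, @MeasurableSet.univ _ (_)⟩, by simp⟩
    (MeasurableSpace.generateFrom_iUnion_measurableSet _).symm V hV ε hε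
  obtain ⟨k, hk⟩ := (hmem B).1 hB
  refine ⟨k, B, hk, ?_⟩
  have hB' : MeasurableSet[forwardSpan G T] B := le_iSup (fun n : ℕ => G.comap T.symm^[n]) k _ hk
  rw [trim_measurableSet_eq hle (@MeasurableSet.symmDiff _ (forwardSpan G T) _ _ hB' hV)] at hBV
  rwa [measure_congr (Filter.EventuallyEq.symmDiff (Filter.EventuallyEq.refl _ B) hUV)]

/-- Under a finite invariant measure, sets that are invariant under some `Tⁿ`, `n ≥ 1`, are
trivial. -/
theorem null_or_conull_of_preimage_iterate {T : Ω ≃ᵐ Ω} {ν : Measure Ω} [IsFiniteMeasure ν]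
    (h : IsExhausting G T ν) (hT : MeasurePreserving T ν ν)
    (htriv : ∀ A : Set Ω, MeasurableSet[tail T G] A → ν A = 0 ∨ ν Aᶜ = 0) {n : ℕ} (hn : 0 < n)
    {U : Set Ω} (hU : MeasurableSet[m] U) (hinv : T^[n] ⁻¹' U =ᵐ[ν] U) :
    ν U = 0 ∨ ν Uᶜ = 0 := by
  obtain ⟨ε, hε, hεsum⟩ := ENNReal.exists_pos_sum_of_countable one_ne_zero ℕ
  have key : ∀ i : ℕ, ∃ B : Set Ω, MeasurableSet[G.comap T^[i]] B ∧
      ν (symmDiff B U) ≤ ε i := by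
    intro i
    obtain ⟨k, B, ⟨D, hD, rfl⟩, hB⟩ := h.exists_measure_symmDiff_lt hU
      (ENNReal.coe_pos.2 (hε i))
    -- Pulling back by `T^[n * (k + i)]` fixes `U` modulo null sets, preserves the error, and moves
    -- the approximant from `Tᵏ G` into `T⁻ⁱ G`, since `n * (k + i) - k ≥ i`.
    have hN : k + i ≤ n * (k + i) := Nat.le_mul_of_pos_left _ hn
    obtain ⟨r, hr⟩ := Nat.exists_eq_add_of_le hN
    have hUN : T^[n * (k + i)] ⁻¹' U =ᵐ[ν] U := by
      rw [Function.iterate_mul]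
      exact (hT.iterate n).quasiMeasurePreserving.preimage_iterate_ae_eq _ hinv
    refine ⟨T^[n * (k + i)] ⁻¹' (T.symm^[k] ⁻¹' D), ?_, ?_⟩
    · refine antitone_comap_iterate h.comap_le (Nat.le_add_right i r) _ ⟨D, hD, ?_⟩
      have hinv : Function.LeftInverse T.symm^[k] T^[k] :=
        Function.LeftInverse.iterate T.symm_apply_apply k
      have hsplit : T^[n * (k + i)] = T^[k] ∘ T^[i + r] := by
        rw [hr, add_assoc, Function.iterate_add]
      rw [hsplit, ← Set.preimage_comp, ← Function.comp_assoc, hinv.comp_eq_id, Function.id_comp]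
    · rw [measure_congr (Filter.EventuallyEq.symmDiff
          (Filter.EventuallyEq.refl _ (T^[n * (k + i)] ⁻¹' (T.symm^[k] ⁻¹' D))) hUN.symm),
        ← Set.preimage_symmDiff, (hT.iterate _).measure_preimage]
      · exact hB.le
      · exact ((comap_symm_iterate_le h.le k _ ⟨D, hD, rfl⟩).symmDiff hU).nullMeasurableSet
  choose B hB hBε using key
  refine null_or_conull_of_tail_approx h.comap_le htriv hB ?_
  exact ((ENNReal.tsum_le_tsum hBε).trans hεsum.le).trans_lt ENNReal.one_lt_top |>.ne

theorem IsExhausting.mono_ac {T : Ω ≃ᵐ Ω} {μ ν : Measure Ω} (h : IsExhausting G T μ)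
    (hν : ν ≪ μ) : IsExhausting G T ν where
  le := h.le
  comap_le := h.comap_le
  generates A hA := by
    obtain ⟨B, hB, hAB⟩ := h.generates A hA
    exact ⟨B, hB, hν.ae_eq hAB⟩

/-- A `K`-system with an equivalent finite invariant measure is of type `II₁`, unless it is a
single atom. -/
theorem IsKAlgebra.isTypeII1 {T : Ω ≃ᵐ Ω} {μ ν : Measure Ω} [IsFiniteMeasure ν]
    (h : IsKAlgebra G T μ) (hνμ : ν ≪ μ) (hμν : μ ≪ ν) (hT : MeasurePreserving T ν ν)
    (hatom : ∃ A : Set Ω, MeasurableSet[m] A ∧ μ A ≠ 0 ∧ μ Aᶜ ≠ 0) : IsTypeII1 T μ := by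
  refine ⟨?_, ν, inferInstance, hνμ, hμν, hT⟩
  rintro ⟨n, A, hA⟩
  have htriv : ∀ B ⊆ A, MeasurableSet[m] B → μ B = 0 ∨ μ Bᶜ = 0 := by
    intro B hBA hB
    have hinj : Function.Injective T^[n] := T.injective.iterate n
    have hinv : T^[n] ⁻¹' B =ᵐ[ν] B := by
      have := (hT.iterate n).quasiMeasurePreserving.preimage_ae_eq
        (hνμ.ae_eq (hA.image_eq B hBA hB))
      rw [hinj.preimage_image] at this
      exact this.symm
    refine (null_or_conull_of_preimage_iterate (h.exhausting.mono_ac hνμ) hT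
      (fun D hD => (h.tail_trivial D hD).imp (fun h => hνμ h) (fun h => hνμ h)) hA.pos hB hinv).imp
      (fun h => hμν h) (fun h => hμν h)
  have hAc : μ Aᶜ = 0 := (htriv A subset_rfl hA.measurableSet).resolve_left hA.measure_ne_zero
  -- `A` is conull and its subsets are trivial, so it cannot be split by `D`.
  obtain ⟨D, hD, hD0, hDc⟩ := hatom
  rcases htriv (A ∩ D) Set.inter_subset_left (hA.measurableSet.inter hD) with h0 | h0
  · refine hD0 (measure_mono_null (fun x hx => ?_) (measure_union_null h0 hAc))
    by_cases hxA : x ∈ A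
    · exact Or.inl ⟨hxA, hx⟩
    · exact Or.inr hxA
  · exact hDc (measure_mono_null (Set.compl_subset_compl.2 Set.inter_subset_right) h0)

end Periodic

/-! ### Scaling of the measure on the half-line. -/

section Scaling

/-- Multiplication by `a > 0` on the half-line. -/
def scale (a : ℝ) (ha : 0 < a) (s : PosReal) : PosReal := ⟨s * a, mul_pos s.2 ha⟩

theorem measurable_scale (a : ℝ) (ha : 0 < a) : Measurable (scale a ha) :=
  (measurable_subtype_coe.mul_const a).subtype_mk

theorem map_scale_comap_volume (a : ℝ) (ha : 0 < a) :
    (Measure.comap (Subtype.val : PosReal → ℝ) volume).map (scale a ha) =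
      ENNReal.ofReal a⁻¹ • Measure.comap (Subtype.val : PosReal → ℝ) volume := by
  ext B hB
  rw [Measure.map_apply (measurable_scale a ha) hB, Measure.smul_apply,
    comap_subtype_coe_apply measurableSet_Ioi, comap_subtype_coe_apply measurableSet_Ioi,
    smul_eq_mul]
  have : (Subtype.val '' (scale a ha ⁻¹' B) : Set ℝ) = (· * a) ⁻¹' (Subtype.val '' B) := by
    ext x
    constructor
    · rintro ⟨s, hs, rfl⟩
      exact ⟨_, hs, rfl⟩
    · rintro ⟨t, ht, htx⟩
      have hx : 0 < x := pos_of_mul_pos_left ((show (t : ℝ) = x * a from htx) ▸ t.2) ha.le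
      refine ⟨⟨x, hx⟩, ?_, rfl⟩
      have : scale a ha ⟨x, hx⟩ = t := Subtype.ext htx.symm
      rwa [Set.mem_preimage, this]
  rw [this, Real.volume_preimage_mul_right ha.ne', abs_of_pos (inv_pos.2 ha)]

theorem measurable_powerMeasure_density (α : ℝ) :
    Measurable fun s : PosReal => ENNReal.ofReal (1 / (s : ℝ) ^ (1 + α)) :=
  (measurable_const.div (measurable_subtype_coe.pow_const _)).ennreal_ofReal

instance (α : ℝ) : SigmaFinite (powerMeasure α) := by
  have : LocallyCompactSpace PosReal := isOpen_Ioi.locallyCompactSpace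
  have : IsFiniteMeasureOnCompacts (Measure.comap (Subtype.val : PosReal → ℝ) volume) :=
    .comap' _ continuous_subtype_val (MeasurableEmbedding.subtype_coe measurableSet_Ioi)
  exact SigmaFinite.withDensity_ofReal _

/-- With `a = c ^ (1 / α)`, the density contributes `a ^ (1 + α)` and Lebesgue measure `a⁻¹`; the
product is `a ^ α = c`. This explains the exponent in `extension`. -/
theorem powerMeasure_preimage_scale {α c : ℝ} (hα : 0 < α) (hc : 0 < c)
    {B : Set PosReal} (hB : MeasurableSet B) :
    powerMeasure α (scale (c ^ (1 / α)) (Real.rpow_pos_of_pos hc _) ⁻¹' B) =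
      ENNReal.ofReal c * powerMeasure α B := by
  set a := c ^ (1 / α) with ha_def
  have ha : 0 < a := Real.rpow_pos_of_pos hc _
  have hscale : ∀ s : PosReal, ENNReal.ofReal (1 / (s : ℝ) ^ (1 + α)) =
      ENNReal.ofReal (a ^ (1 + α)) * ENNReal.ofReal (1 / (scale a ha s : ℝ) ^ (1 + α)) := by
    intro s
    have hs : (0 : ℝ) < s := s.2
    rw [← ENNReal.ofReal_mul (by positivity)]
    congr 1
    rw [scale, Real.mul_rpow hs.le ha.le]
    have := (Real.rpow_pos_of_pos ha (1 + α)).ne'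
    have := (Real.rpow_pos_of_pos hs (1 + α)).ne'
    field_simp
  have hac : a ^ (1 + α) * a⁻¹ = c := by
    rw [Real.rpow_add ha, Real.rpow_one, mul_right_comm, mul_inv_cancel₀ ha.ne', one_mul, ha_def,
      ← Real.rpow_mul hc.le, one_div, inv_mul_cancel₀ hα.ne', Real.rpow_one]
  have hw := measurable_powerMeasure_density α
  rw [powerMeasure, withDensity_apply _ (measurable_scale a ha hB), withDensity_apply _ hB,
    lintegral_congr hscale, ← setLIntegral_map hB (f := fun t : PosReal => ENNReal.ofReal (a ^ (1 + α)) *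
      ENNReal.ofReal (1 / (t : ℝ) ^ (1 + α))) (hw.const_mul _) (measurable_scale a ha),
    map_scale_comap_volume, Measure.restrict_smul, lintegral_smul_measure,
    lintegral_const_mul _ hw, smul_eq_mul, ← mul_assoc, ← ENNReal.ofReal_mul (by positivity),
    mul_comm a⁻¹, hac]

end Scaling

/-! ### The Jacobian: change of variables and measurability. -/

section Jacobian

variable {Ω : Type*} {G m : MeasurableSpace Ω} {T : Ω ≃ᵐ Ω} {μ : Measure Ω}

theorem IsNonsingular.quasiMeasurePreserving (h : IsNonsingular T μ) :
    Measure.QuasiMeasurePreserving T μ μ :=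
  ⟨T.measurable, h.map_ac⟩

theorem IsNonsingular.map_symm_ac (h : IsNonsingular T μ) : μ.map T.symm ≪ μ := by
  simpa using h.ac_map.map T.symm.measurable

theorem IsNonsingular.ac_map_symm (h : IsNonsingular T μ) : μ ≪ μ.map T.symm := by
  simpa using h.map_ac.map T.symm.measurable

variable [SigmaFinite μ]

theorem IsNonsingular.ofReal_jacobian (h : IsNonsingular T μ) :
    (fun ω => ENNReal.ofReal (jacobian T μ ω)) =ᵐ[μ] (μ.map T.symm).rnDeriv μ := by
  have : SigmaFinite (μ.map T.symm) := T.symm.sigmaFinite_map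
  filter_upwards [Measure.rnDeriv_ne_top (μ.map T.symm) μ,
    h.ac_map_symm.ae_le (Measure.rnDeriv_pos h.map_symm_ac)] with ω hω hω'
  rw [jacobian, if_pos (ENNReal.toReal_pos hω'.ne' hω), ENNReal.ofReal_toReal hω]

theorem IsNonsingular.lintegral_jacobian_mul_comp (h : IsNonsingular T μ) {F : Ω → ℝ≥0∞}
    (hF : Measurable F) :
    ∫⁻ ω, ENNReal.ofReal (jacobian T μ ω) * F (T ω) ∂μ = ∫⁻ ω, F ω ∂μ := by
  have : SigmaFinite (μ.map T.symm) := T.symm.sigmaFinite_map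
  calc
    _ = ∫⁻ ω, (μ.map T.symm).rnDeriv μ ω * F (T ω) ∂μ :=
      lintegral_congr_ae (h.ofReal_jacobian.mul (Filter.EventuallyEq.refl _ _))
    _ = ∫⁻ ω, F (T ω) ∂(μ.map T.symm) :=
      lintegral_rnDeriv_mul h.map_symm_ac (hF.comp T.measurable).aemeasurable
    _ = ∫⁻ ω, F ω ∂μ := by
      rw [lintegral_map_equiv]
      simp

/-- The Jacobian has a positive version that is measurable for the algebra witnessing the
`K`-property. -/
theorem IsKAlgebra.exists_jacobian_eq (hG : IsKAlgebra G T μ)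
    (h : IsNonsingular T μ) :
    ∃ ψ : Ω → ℝ, Measurable[G] ψ ∧ (∀ ω, 0 < ψ ω) ∧ jacobian T μ =ᵐ[μ] ψ := by
  obtain ⟨φ, hφ, hφeq⟩ := hG.rnDeriv_measurable
  have : SigmaFinite (μ.map T) := T.sigmaFinite_map
  -- The same truncation as in `jacobian`, which makes the version positive everywhere.
  let g : ℝ≥0∞ → ℝ := fun x => if 0 < x.toReal then x.toReal else 1
  have hg : Measurable g :=
    Measurable.ite (measurableSet_lt measurable_const ENNReal.measurable_toReal)
      ENNReal.measurable_toReal measurable_const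
  have hTG : Measurable[G, G] T := fun A hA => hG.exhausting.comap_le _ ⟨A, hA, rfl⟩
  refine ⟨fun ω => g (φ (T ω)), hg.comp (hφ.comp hTG), fun ω => ?_, ?_⟩
  · by_cases hω : 0 < (φ (T ω)).toReal
    · simpa only [g, if_pos hω] using hω
    · simp only [g, if_neg hω, one_pos]
  -- Transporting by `T⁻¹` gives `d(T⁻¹)_* μ / dμ = (dμ / dT_* μ) ∘ T`, and composition with `T`
  -- preserves `G`-measurability.
  · have h1 : (fun x => (μ.map T.symm).rnDeriv μ (T.symm x)) =ᵐ[μ.map T]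
        μ.rnDeriv (μ.map T) := by
      have := T.symm.measurableEmbedding.rnDeriv_map μ (μ.map T)
      rwa [Measure.map_map T.symm.measurable T.measurable, T.symm_comp_self, Measure.map_id] at this
    have h2 := h1.trans (h.map_ac.ae_eq hφeq)
    have h3 := ae_of_ae_map T.measurable.aemeasurable h2
    filter_upwards [h3] with ω hω
    rw [T.symm_apply_apply] at hω
    simp only [jacobian, hω, g]

end Jacobian

/-! ### Fibre measures, invariance, and the exhausting σ-algebra of the extension. -/

section Extension

variable {Ω : Type*} {G m : MeasurableSpace Ω} {T : Ω ≃ᵐ Ω} {μ : Measure Ω} {α : ℝ}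

/-- The measure of the fibre of `E` over `ω`. -/
noncomputable def fibre (α : ℝ) (E : Set (Ω × PosReal)) (ω : Ω) : ℝ≥0∞ :=
  powerMeasure α (Prod.mk ω ⁻¹' E)

theorem measurable_fibre {E : Set (Ω × PosReal)} (hE : MeasurableSet E) :
    Measurable (fibre α E) :=
  measurable_measure_prodMk_left hE

theorem fibre_extension_preimage (hα : 0 < α) {E : Set (Ω × PosReal)} (hE : MeasurableSet E)
    (ω : Ω) :
    fibre α (extension T μ α ⁻¹' E) ω =
      ENNReal.ofReal (jacobian T μ ω) * fibre α E (T ω) := by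
  have hsec : Prod.mk ω ⁻¹' (extension T μ α ⁻¹' E) =
      scale (jacobian T μ ω ^ (1 / α)) (Real.rpow_pos_of_pos (jacobian_pos T μ ω) _) ⁻¹'
        (Prod.mk (T ω) ⁻¹' E) := by
    ext s
    exact Iff.rfl
  rw [fibre, hsec, powerMeasure_preimage_scale hα (jacobian_pos T μ ω) (measurable_prodMk_left hE), fibre]

theorem fibre_ae_eq {E E' : Set (Ω × PosReal)} (h : E =ᵐ[μ.prod (powerMeasure α)] E') :
    fibre α E =ᵐ[μ] fibre α E' := by
  filter_upwards [Measure.ae_ae_of_ae_prod h] with ω hω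
  exact measure_congr hω

theorem lintegral_fibre {E : Set (Ω × PosReal)} (hE : MeasurableSet E) :
    ∫⁻ ω, fibre α E ω ∂μ = μ.prod (powerMeasure α) E :=
  (Measure.prod_apply hE).symm

theorem setLIntegral_fibre {E : Set (Ω × PosReal)} (hE : MeasurableSet E) {A : Set Ω}
    (hA : MeasurableSet A) :
    ∫⁻ ω in A, fibre α E ω ∂μ = μ.prod (powerMeasure α) (E ∩ Prod.fst ⁻¹' A) := by
  rw [Measure.prod_apply (hE.inter (measurable_fst hA)), ← lintegral_indicator hA]
  refine lintegral_congr fun ω => ?_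
  by_cases hω : ω ∈ A
  · simp [hω, fibre, Set.preimage_preimage]
  · simp [hω, Set.preimage_preimage]

/-- `G ⊗ B₊`, completed by the null sets. -/
@[reducible] noncomputable def completedProd {Ω : Type*} (G : MeasurableSpace Ω) {m : MeasurableSpace Ω}
    (μ : Measure Ω) (α : ℝ) :
    MeasurableSpace (Ω × PosReal) :=
  eventuallyMeasurableSpace (G.prod inferInstance) (ae (μ.prod (powerMeasure α))) ⊓
    Prod.instMeasurableSpace

theorem prod_le_completedProd (hG : G ≤ m) :
    G.prod inferInstance ≤ completedProd G μ α :=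
  le_inf le_eventuallyMeasurableSpace (sup_le_sup (MeasurableSpace.comap_mono hG) le_rfl)

variable [SigmaFinite μ]

theorem measurePreserving_extension (h : IsNonsingular T μ) (hα : 0 < α) :
    MeasurePreserving (extension T μ α) (μ.prod (powerMeasure α)) (μ.prod (powerMeasure α)) := by
  refine ⟨(extension T μ α).measurable, ?_⟩
  ext E hE
  rw [Measure.map_apply (extension T μ α).measurable hE, Measure.prod_apply hE,
    Measure.prod_apply ((extension T μ α).measurable hE)]
  exact (lintegral_congr fun ω => fibre_extension_preimage hα hE ω).trans
    (h.lintegral_jacobian_mul_comp (measurable_fibre hE))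

/-- The σ-algebra on `X` is left free so that it can be taken to be `G`. -/
theorem measurable_skewProduct {X : Type*} [MeasurableSpace X] {f : X → X} (hf : Measurable f)
    {ψ : X → ℝ} (hψ : Measurable ψ) (hpos : ∀ x, 0 < ψ x) (β : ℝ) :
    Measurable fun p : X × PosReal =>
      (f p.1, scale (ψ p.1 ^ β) (Real.rpow_pos_of_pos (hpos _) _) p.2) := by
  refine (hf.comp measurable_fst).prodMk (Measurable.subtype_mk ?_)
  exact (measurable_subtype_coe.comp measurable_snd).mul ((hψ.comp measurable_fst).pow_const _)

/-- The Jacobian is only a.e. equal to a `G`-measurable function `ψ`. Replacing it by `ψ` changes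
preimages by null sets, which the completion absorbs. -/
theorem comap_completedProd_le (h : IsNonsingular T μ) (hG : IsKAlgebra G T μ) (hα : 0 < α) :
    (completedProd G μ α).comap (extension T μ α) ≤ completedProd G μ α := by
  rintro _ ⟨E, hE, rfl⟩
  obtain ⟨⟨E', hE', hEE'⟩, hEm⟩ := MeasurableSpace.measurableSet_inf.1 hE
  refine MeasurableSpace.measurableSet_inf.2 ⟨?_, (extension T μ α).measurable hEm⟩
  obtain ⟨ψ, hψ, hpos, hJψ⟩ := hG.exists_jacobian_eq h
  have hTG : Measurable[G, G] T := fun A hA => hG.exhausting.comap_le _ ⟨A, hA, rfl⟩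
  refine ⟨_, @measurable_skewProduct Ω G T hTG ψ hψ hpos (1 / α) E' hE', ?_⟩
  refine ((measurePreserving_extension h hα).quasiMeasurePreserving.preimage_ae_eq hEE').trans ?_
  refine Filter.eventuallyEq_set.2 ?_
  filter_upwards [Measure.quasiMeasurePreserving_fst.ae hJψ] with p hp
  have : extension T μ α p = (T p.1, scale (ψ p.1 ^ (1 / α))
      (Real.rpow_pos_of_pos (hpos _) _) p.2) := by
    refine Prod.ext rfl (Subtype.ext ?_)
    change (p.2 : ℝ) * jacobian T μ p.1 ^ (1 / α) = (p.2 : ℝ) * ψ p.1 ^ (1 / α)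
    rw [hp]
  rw [Set.mem_preimage, Set.mem_preimage, this]

theorem isExhausting_completedProd (h : IsNonsingular T μ) (hG : IsKAlgebra G T μ) (hα : 0 < α) :
    IsExhausting (completedProd G μ α) (extension T μ α) (μ.prod (powerMeasure α)) where
  le := inf_le_right
  comap_le := comap_completedProd_le h hG hα
  generates := by
    have hle := prod_le_completedProd (μ := μ) (α := α) hG.exhausting.le
    suffices hs : Prod.instMeasurableSpace ≤ eventuallyMeasurableSpace
        (forwardSpan (completedProd G μ α) (extension T μ α)) (ae (μ.prod (powerMeasure α))) from
      fun A hA => hs A hA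
    refine sup_le ?_ ?_
    · rintro _ ⟨A, hA, rfl⟩
      obtain ⟨B, hB, hAB⟩ := hG.exhausting.generates A hA
      refine ⟨Prod.fst ⁻¹' B, ?_, Measure.quasiMeasurePreserving_fst.preimage_ae_eq hAB⟩
      have hspan : (forwardSpan G T).comap Prod.fst ≤
          forwardSpan (completedProd G μ α) (extension T μ α) := by
        rw [forwardSpan, MeasurableSpace.comap_iSup]
        refine iSup_mono fun n => ?_
        -- The first projection intertwines the inverses, so `Tⁿ G` lifts into the `n`-th image; the
        -- half-line coordinate is already present at `n = 0`.
        have hsemi : Function.Semiconj (Prod.fst : Ω × PosReal → Ω)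
            (extension T μ α).symm T.symm := fun _ => rfl
        rw [MeasurableSpace.comap_comp, ← (hsemi.iterate_right n).comp_eq,
          ← MeasurableSpace.comap_comp]
        exact MeasurableSpace.comap_mono (le_sup_left.trans hle)
      exact hspan _ ⟨B, hB, rfl⟩
    · refine le_trans ?_ le_eventuallyMeasurableSpace
      refine (le_sup_right.trans hle).trans ?_
      refine le_trans ?_ (le_iSup _ 0)
      simp [MeasurableSpace.comap_id]

end Extension

/-! ### Remote sets of finite measure. -/

section RemoteSets

variable {Ω : Type*} {G m : MeasurableSpace Ω} {T : Ω ≃ᵐ Ω} {μ : Measure Ω} {α : ℝ}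

theorem IsKAlgebra.null_or_conull_of_coherent (h : IsNonsingular T μ) (hG : IsKAlgebra G T μ)
    {D : ℕ → Set Ω} (hD : ∀ n, D n = T ⁻¹' D (n + 1))
    (hDG : ∀ n, ∃ B : Set Ω, MeasurableSet[G] B ∧ D n =ᵐ[μ] B) :
    μ (D 0) = 0 ∨ μ (D 0)ᶜ = 0 := by
  have hD0 : ∀ n, D 0 = T^[n] ⁻¹' D n := by
    intro n
    induction n with
    | zero => rfl
    | succ n ih => rw [ih, hD n, Function.iterate_succ', Set.preimage_comp]
  refine null_or_conull_of_ae_eq hG.exhausting.comap_le hG.tail_trivial fun n => ?_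
  obtain ⟨B, hB, hBD⟩ := hDG n
  refine ⟨T^[n] ⁻¹' B, ⟨B, hB, rfl⟩, ?_⟩
  rw [hD0 n]
  exact ((h.quasiMeasurePreserving.iterate n).preimage_ae_eq hBD).symm

/-- A remote set of finite positive measure yields a finite invariant measure on the base. -/
theorem exists_invariant_of_remote [SigmaFinite μ] (h : IsNonsingular T μ)
    (hG : IsKAlgebra G T μ) (hα : 0 < α) {E : Set (Ω × PosReal)}
    (hE : MeasurableSet[tail (extension T μ α) (completedProd G μ α)] E)
    (hE0 : μ.prod (powerMeasure α) E ≠ 0) (hEtop : μ.prod (powerMeasure α) E ≠ ∞) :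
    ∃ ν : Measure Ω, IsFiniteMeasure ν ∧ ν ≪ μ ∧ μ ≪ ν ∧ MeasurePreserving T ν ν := by
  set S := extension T μ α
  have hpres := measurePreserving_extension h hα
  have hEn : ∀ n : ℕ, ∃ F : Set (Ω × PosReal), MeasurableSet[completedProd G μ α] F ∧ S^[n] ⁻¹' F = E :=
    fun n => MeasurableSpace.measurableSet_iInf.1 hE n
  choose F hF hFE using hEn
  have hFm : ∀ n, MeasurableSet (F n) := fun n => (MeasurableSpace.measurableSet_inf.1 (hF n)).2
  have hFsucc : ∀ n, F n = S ⁻¹' F (n + 1) := by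
    intro n
    -- The `F n` are chosen separately, but surjectivity of `S^[n]` determines each from `E`, so
    -- they are coherent.
    refine (S.surjective.iterate n).preimage_injective ?_
    rw [hFE n, ← Set.preimage_comp, ← Function.iterate_succ', hFE (n + 1)]
  have hF0 : F 0 = E := hFE 0
  set f : ℕ → Ω → ℝ≥0∞ := fun n => fibre α (F n) with hf
  have hfm : ∀ n, Measurable (f n) := fun n => measurable_fibre (hFm n)
  have hfsucc : ∀ n ω, f n ω = ENNReal.ofReal (jacobian T μ ω) * f (n + 1) (T ω) := by
    intro n ω
    simp only [hf]
    rw [hFsucc n, fibre_extension_preimage hα (hFm _)]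
  have hJ0 : ∀ ω, ENNReal.ofReal (jacobian T μ ω) ≠ 0 := fun ω =>
    (ENNReal.ofReal_pos.2 (jacobian_pos T μ ω)).ne'
  have hfG : ∀ n, ∃ g : Ω → ℝ≥0∞, Measurable[G] g ∧ f n =ᵐ[μ] g := by
    intro n
    obtain ⟨F', hF', hFF'⟩ := (MeasurableSpace.measurableSet_inf.1 (hF n)).1
    exact ⟨fibre α F', @measurable_fibre Ω G α F' hF', fibre_ae_eq hFF'⟩
  choose g hg hfg using hfG
  have hlt := hG.null_or_conull_of_coherent h (D := fun n => {ω | f (n + 1) ω < f n ω})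
    (fun n => by
      ext ω
      simp only [Set.mem_ofPred_eq, Set.mem_preimage]
      rw [hfsucc n, hfsucc (n + 1), ENNReal.mul_lt_mul_iff_right (hJ0 ω) ENNReal.ofReal_ne_top])
    (fun n => ⟨{ω | g (n + 1) ω < g n ω}, measurableSet_lt (hg _) (hg _), by
      refine Filter.eventuallyEq_set.2 ?_
      filter_upwards [hfg n, hfg (n + 1)] with ω h1 h2
      simp only [h1, h2]⟩)
  have hpos := hG.null_or_conull_of_coherent h (D := fun n => {ω | f n ω ≠ 0})
    (fun n => by
      ext ω
      simp only [Set.mem_ofPred_eq, Set.mem_preimage]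
      rw [hfsucc n, mul_ne_zero_iff]
      exact ⟨fun h => h.2, fun h => ⟨hJ0 ω, h⟩⟩)
    (fun n => ⟨{ω | g n ω ≠ 0}, hg n (measurableSet_singleton 0).compl, by
      refine Filter.eventuallyEq_set.2 ?_
      filter_upwards [hfg n] with ω h1
      simp only [h1]⟩)
  have hint0 : ∫⁻ ω, f 0 ω ∂μ = μ.prod (powerMeasure α) E := by
    rw [hf, lintegral_fibre (hFm 0), hF0]
  have hint : ∫⁻ ω, f 0 ω ∂μ = ∫⁻ ω, f 1 ω ∂μ := by
    simp only [hf]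
    rw [lintegral_fibre (hFm 0), lintegral_fibre (hFm 1), hFsucc 0,
      hpres.measure_preimage (hFm 1).nullMeasurableSet]
  -- By triviality `f 0` and `f 1` are ordered a.e. one way or the other; equal finite integrals
  -- then force equality.
  have heq : f 0 =ᵐ[μ] f 1 := by
    rcases hlt with h0 | h0
    · refine ae_eq_of_ae_le_of_lintegral_le ?_ (hint0 ▸ hEtop) (hfm 1).aemeasurable hint.ge
      filter_upwards [measure_eq_zero_iff_ae_notMem.1 h0] with ω hω
      exact not_lt.1 hω
    · refine (ae_eq_of_ae_le_of_lintegral_le ?_ (hint ▸ hint0 ▸ hEtop) (hfm 0).aemeasurable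
        hint.le).symm
      filter_upwards [measure_eq_zero_iff_ae_notMem.1 h0] with ω hω
      exact (not_not.1 hω).le
  have hne : ∀ᵐ ω ∂μ, f 0 ω ≠ 0 := by
    refine ae_iff.2 (hpos.resolve_left fun h0 => hE0 ?_)
    rw [← hint0, lintegral_eq_zero_iff (hfm 0)]
    filter_upwards [measure_eq_zero_iff_ae_notMem.1 h0] with ω hω
    exact not_not.1 hω
  refine ⟨μ.withDensity (f 0), isFiniteMeasure_withDensity (hint0 ▸ hEtop),
    withDensity_absolutelyContinuous _ _,
    withDensity_absolutelyContinuous' (hfm 0).aemeasurable hne, T.measurable, ?_⟩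
  ext A hA
  rw [Measure.map_apply T.measurable hA, withDensity_apply _ (T.measurable hA),
    withDensity_apply _ hA, setLIntegral_congr_fun_ae hA (heq.mono fun ω hω _ => hω)]
  simp only [hf]
  -- The part of `F 0` over `T⁻¹ A` is the `S`-preimage of the part of `F 1` over `A`, so invariance
  -- of the product measure finishes.
  rw [setLIntegral_fibre (hFm 0) (T.measurable hA), setLIntegral_fibre (hFm 1) hA, hFsucc 0,
    ← hpres.measure_preimage ((hFm 1).inter (measurable_fst hA)).nullMeasurableSet]
  rfl

end RemoteSets

/-- The Maharam extension of a `K`-system that is not of type `II₁` is remotely infinite. -/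
theorem IsKAlgebra.isRemotelyInfinite {Ω : Type*} {G m : MeasurableSpace Ω} {T : Ω ≃ᵐ Ω}
    {μ : Measure Ω} [SigmaFinite μ] {α : ℝ} (hG : IsKAlgebra G T μ) (h : IsNonsingular T μ)
    (hα : 0 < α) (hatom : ∃ A : Set Ω, MeasurableSet[m] A ∧ μ A ≠ 0 ∧ μ Aᶜ ≠ 0)
    (hII : ¬ IsTypeII1 T μ) :
    IsRemotelyInfinite (extension T μ α) (μ.prod (powerMeasure α)) := by
  refine ⟨measurePreserving_extension h hα, completedProd G μ α,
    isExhausting_completedProd h hG hα, fun E hE => ?_⟩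
  by_contra! hcon
  obtain ⟨ν, hν, hνμ, hμν, hT⟩ := exists_invariant_of_remote h hG hα hE hcon.1 hcon.2
  exact hII (hG.isTypeII1 hνμ hμν hT hatom)

end Maharam

theorem mainTheorem6 {Ω : Type*} [MeasurableSpace Ω] (μ : Measure Ω) [SigmaFinite μ]
    (T : Ω ≃ᵐ Ω) (α : ℝ) (hα₀ : 0 < α) (hα₂ : α < 2)
    (hatom : ∃ A : Set Ω, MeasurableSet A ∧ μ A ≠ 0 ∧ μ Aᶜ ≠ 0)
    (hK : Maharam.IsKSystem T μ) (hII : ¬ Maharam.IsTypeII1 T μ) :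
    Maharam.IsRemotelyInfinite (Maharam.extension T μ α)
      (μ.prod (Maharam.powerMeasure α)) := by
  have hns := hK.nonsingular
  exact hK.exists_algebra.elim fun _ hG => hG.isRemotelyInfinite hns hα₀ hatom hII
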